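/- Let $\varphi_n$ be the $n$-th partial recursive function. Realizability truth values are subsets of $\mathbb N$, with $A\wedge B$ the set of codes $\langle m,n\rangle$ of pairs with $m\in A$, $n\in B$; $A\vee B=\{\langle 0,n\rangle : n\in A\}\cup\{\langle 1,n\rangle : n\in B\}$; $A\Rightarrow B=\{n : \varphi_n(m)\text{ is defined and in }B\text{ for all }m\in A\}$; $\bot=\emptyset$. A closed truth value is valid if it is non-empty. An object $X$ of the effective topos $\mathsf{Eff}$ is a set $|X|$ with a symmetric and transitive equality predicate $[x=_Xy]\subseteq\mathbb N$ (symmetry and transitivity being realized uniformly), and a morphism is an equivalence class of functional relations. Quantifiers over $X$ are interpreted by $\forall x\in X.\,\phi:=\bigcap_x([x=_Xx]\Rightarrow\phi(x))$ and $\exists x\in X.\,\phi:=\bigcup_x([x=_Xx]\wedge\phi(x))$. $\mathcal P(X)$ denotes the powerobject of $X$. For a set $S$, $\nabla S$ is the object $S$ with $[x=y]=\mathbb N$ if $x=y$ and $\emptyset$ otherwise; a map $f:S\to T$ induces $\nabla f:\nabla S\to\nabla T$, represented by $(x,y)\mapsto[f(x)=y]$. The double-negation closure $\mathsf{cl}_{\neg\neg}:\mathcal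 P(\nabla S)\to\nabla(PS)$ sends $A$ to $\{x\in S : \neg\neg A(x)\text{ is valid}\}$. Let $(\omega_1,\preceq)$ be the set of countable ordinals with its usual order, let $P_{\mathrm c}(\omega_1)$ be the set of countable subsets of $\omega_1$, let $j:P_{\mathrm c}(\omega_1)\to P(\omega_1)$ be the inclusion and let $\sup:P_{\mathrm c}(\omega_1)\to\omega_1$ be the supremum map. Equip $\nabla\omega_1$ with the relation $\nabla{\preceq}$, interpreted by $\mathbb N$ if $x\preceq y$ and by $\emptyset$ otherwise. Let $$\mathsf{Ch}(\nabla\omega_1)=\{C\in\mathcal P(\nabla\omega_1) : \forall x,y\in\nabla\omega_1.\ x\in C\wedge y\in C\Rightarrow x\preceq y\vee y\preceq x\}$$ be the object of chains, formed in $\mathsf{Eff}$, with inclusion $i:\mathsf{Ch}(\nabla\omega_1)\to\mathcal P(\nabla\omega_1)$. **Proposition.** In the internal language of $\mathsf{Eff}$, $(\nabla\omega_1,\nabla{\preceq})$ is a poset, and it is chain-complete: it is valid in $\mathsf{Eff}$ that every $C\in\mathsf{Ch}(\nabla\omega_1)$ has a supremum in $\nabla\omega_1$. Moreover, there is a unique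 morphism $c:\mathsf{Ch}(\nabla\omega_1)\to\nabla P_{\mathrm c}(\omega_1)$ with $\nabla j\circ c=\mathsf{cl}_{\neg\neg}\circ i$ (the $\neg\neg$-closure of a chain is a countable subset of $\omega_1$), and $\nabla{\sup}\circ c$ is the supremum operator: it is valid in $\mathsf{Eff}$ that $(\nabla{\sup}\circ c)(C)$ is the supremum of $C$ for every $C\in\mathsf{Ch}(\nabla\omega_1)$. -/

import Mathlib

open CategoryTheory

universe u

namespace EffTopos

/-! ### Realizability: truth values are sets of natural numbers -/

/-- `app n m` is `φ_n(m)`, where `φ_n` is the `n`-th partial recursive function. -/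
def app (n m : ℕ) : Part ℕ :=
  (Denumerable.ofNat Nat.Partrec.Code n).eval m

/-- `A ∧ B` is the set of (codes of) pairs `⟨m, n⟩` with `m ∈ A` and `n ∈ B`. -/
def tand (A B : Set ℕ) : Set ℕ :=
  {p | p.unpair.1 ∈ A ∧ p.unpair.2 ∈ B}

/-- `A ∨ B` is `{⟨0, n⟩ | n ∈ A} ∪ {⟨1, n⟩ | n ∈ B}`. -/
def tor (A B : Set ℕ) : Set ℕ :=
  {p | (p.unpair.1 = 0 ∧ p.unpair.2 ∈ A) ∨ (p.unpair.1 = 1 ∧ p.unpair.2 ∈ B)}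

/-- `A ⇒ B` is the set of those `n` for which `φ_n(m)` is defined and belongs to `B`, for all
`m ∈ A`. -/
def timp (A B : Set ℕ) : Set ℕ :=
  {n | ∀ m ∈ A, ∃ k ∈ app n m, k ∈ B}

infixr:35 " ∧ʳ " => tand
infixr:30 " ∨ʳ " => tor
infixr:25 " ⇒ʳ " => timp

/-- `¬ A` is `A ⇒ ⊥`, where `⊥` is the empty set. -/
def tneg (A : Set ℕ) : Set ℕ := A ⇒ʳ ∅

/-- A closed truth value is valid when it has a realizer. -/
def Valid (A : Set ℕ) : Prop := A.Nonempty

/-- The Heyting preorder on non-standard predicates on `ι`: a single program translates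
realizers of `A i` to realizers of `B i`, uniformly in `i`. -/
def Ent {ι : Type*} (A B : ι → Set ℕ) : Prop := Valid (⋂ i, (A i ⇒ʳ B i))

/-! Basic rules of the entailment, used only to justify the definitions below. -/

theorem exists_app {f : ℕ →. ℕ} (hf : Nat.Partrec f) : ∃ n, ∀ m, app n m = f m := by
  obtain ⟨c, hc⟩ := Nat.Partrec.Code.exists_code.1 hf
  exact ⟨Encodable.encode c, fun m => by simp [app, hc]⟩

theorem app_partrec : Partrec₂ app :=
  Nat.Partrec.Code.eval_part.comp ((Computable.ofNat _).comp Computable.fst) Computable.snd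

section Rules

variable {ι κ : Type*} {G A B C : ι → Set ℕ}

theorem Ent.iff : Ent A B ↔ ∃ n, ∀ i, ∀ m ∈ A i, ∃ k ∈ app n m, k ∈ B i := by
  simp [Ent, Valid, Set.Nonempty, timp]

theorem Ent.of_partrec {f : ℕ →. ℕ} (hf : Nat.Partrec f)
    (h : ∀ i, ∀ m ∈ A i, ∃ k ∈ f m, k ∈ B i) : Ent A B := by
  obtain ⟨n, hn⟩ := exists_app hf
  exact Ent.iff.2 ⟨n, fun i m hm => by rw [hn]; exact h i m hm⟩

theorem Ent.of_computable {f : ℕ → ℕ} (hf : Computable f)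
    (h : ∀ i, ∀ m ∈ A i, f m ∈ B i) : Ent A B :=
  Ent.of_partrec (Partrec.nat_iff.1 hf.partrec)
    fun i m hm => ⟨f m, by simp, h i m hm⟩

theorem Ent.refl (A : ι → Set ℕ) : Ent A A :=
  Ent.of_computable Computable.id fun _ _ h => h

theorem Ent.trans (h : Ent A B) (h' : Ent B C) : Ent A C := by
  obtain ⟨n, hn⟩ := Ent.iff.1 h
  obtain ⟨k, hk⟩ := Ent.iff.1 h'
  refine Ent.of_partrec (f := fun m => (app n m).bind (app k)) (Partrec.nat_iff.1 ?_) ?_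
  · exact (app_partrec.comp (Computable.const n) Computable.id).bind
      (app_partrec.comp (Computable.const k) Computable.snd)
  · intro i m hm
    obtain ⟨a, ha, ha'⟩ := hn i m hm
    obtain ⟨b, hb, hb'⟩ := hk i a ha'
    exact ⟨b, Part.mem_bind ha hb, hb'⟩

theorem Ent.fst (h : Ent G fun i => A i ∧ʳ B i) : Ent G A :=
  h.trans (Ent.of_computable (Computable.fst.comp Computable.unpair) fun _ _ h => h.1)

theorem Ent.snd (h : Ent G fun i => A i ∧ʳ B i) : Ent G B :=
  h.trans (Ent.of_computable (Computable.snd.comp Computable.unpair) fun _ _ h => h.2)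

theorem Ent.and (h : Ent G A) (h' : Ent G B) : Ent G fun i => A i ∧ʳ B i := by
  obtain ⟨n, hn⟩ := Ent.iff.1 h
  obtain ⟨k, hk⟩ := Ent.iff.1 h'
  refine Ent.of_partrec
    (f := fun m => (app n m).bind fun a => (app k m).map fun b => Nat.pair a b)
    (Partrec.nat_iff.1 ?_) ?_
  · refine (app_partrec.comp (Computable.const n) Computable.id).bind ?_
    refine (app_partrec.comp (Computable.const k) Computable.fst).map ?_
    exact Primrec₂.natPair.to_comp.comp (Computable.snd.comp Computable.fst) Computable.snd
  · intro i m hm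
    obtain ⟨a, ha, ha'⟩ := hn i m hm
    obtain ⟨b, hb, hb'⟩ := hk i m hm
    exact ⟨Nat.pair a b, Part.mem_bind ha (Part.mem_map _ hb), by simpa [tand] using ⟨ha', hb'⟩⟩

theorem Ent.mp (h : Ent G fun i => A i ⇒ʳ B i) (h' : Ent G A) : Ent G B := by
  refine (h.and h').trans (Ent.of_partrec (f := fun p => app p.unpair.1 p.unpair.2)
    (Partrec.nat_iff.1 ?_) ?_)
  · exact app_partrec.comp (Computable.fst.comp Computable.unpair)
      (Computable.snd.comp Computable.unpair)
  · intro i m hm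
    exact hm.1 _ hm.2

theorem Ent.imp (h : Ent (fun i => G i ∧ʳ A i) B) : Ent G fun i => A i ⇒ʳ B i := by
  obtain ⟨n, hn⟩ := Ent.iff.1 h
  refine Ent.of_computable
    (f := fun m => Encodable.encode
      (Nat.Partrec.Code.curry (Denumerable.ofNat Nat.Partrec.Code n) m)) ?_ ?_
  · exact Computable.encode.comp
      (Nat.Partrec.Code.primrec₂_curry.to_comp.comp (Computable.const _) Computable.id)
  · intro i m hm a ha
    have := hn i (Nat.pair m a) (by simpa [tand] using ⟨hm, ha⟩)
    simpa [app, Nat.Partrec.Code.eval_curry] using this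

theorem Ent.orElim (h : Ent G fun i => A i ∨ʳ B i) (hA : Ent (fun i => G i ∧ʳ A i) C)
    (hB : Ent (fun i => G i ∧ʳ B i) C) : Ent G C := by
  obtain ⟨a, ha⟩ := Ent.iff.1 hA.imp
  obtain ⟨b, hb⟩ := Ent.iff.1 hB.imp
  have hab : Ent (fun i => G i ∧ʳ (A i ∨ʳ B i)) fun i => C i := by
    refine Ent.of_partrec
      (f := fun p => (app (if p.unpair.2.unpair.1 = 0 then a else b) p.unpair.1).bind
        fun e => app e p.unpair.2.unpair.2) (Partrec.nat_iff.1 ?_) ?_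
    · have h2 : Computable fun p : ℕ => p.unpair.2.unpair :=
        Computable.unpair.comp (Computable.snd.comp Computable.unpair)
      refine (app_partrec.comp ?_ (Computable.fst.comp Computable.unpair)).bind
        (app_partrec.comp Computable.snd
          ((Computable.snd.comp h2).comp Computable.fst))
      refine (Primrec.ite ?_ (Primrec.const a) (Primrec.const b)).to_comp
      exact Primrec.eq.comp (Primrec.fst.comp (Primrec.unpair.comp
        (Primrec.snd.comp Primrec.unpair))) (Primrec.const 0)
    · rintro i p ⟨hG, ⟨h0, hA⟩ | ⟨h1, hB⟩⟩
      · obtain ⟨e, he, he'⟩ := ha i _ hG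
        obtain ⟨k, hk, hk'⟩ := he' _ hA
        exact ⟨k, Part.mem_bind (by simpa [h0] using he) hk, hk'⟩
      · obtain ⟨e, he, he'⟩ := hb i _ hG
        obtain ⟨k, hk, hk'⟩ := he' _ hB
        exact ⟨k, Part.mem_bind (by simpa [h1] using he) hk, hk'⟩
  exact ((Ent.refl G).and h).trans hab

theorem Ent.orInl (h : Ent G A) : Ent G fun i => A i ∨ʳ B i :=
  h.trans (Ent.of_computable (f := fun m => Nat.pair 0 m)
    (Primrec₂.natPair.to_comp.comp (Computable.const 0) Computable.id)
    fun i m hm => Or.inl (by simpa using hm))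

theorem Ent.orInr (h : Ent G B) : Ent G fun i => A i ∨ʳ B i :=
  h.trans (Ent.of_computable (f := fun m => Nat.pair 1 m)
    (Primrec₂.natPair.to_comp.comp (Computable.const 1) Computable.id)
    fun i m hm => Or.inr (by simpa using hm))

/-- Reindexing. -/
theorem Ent.comp (f : κ → ι) (h : Ent A B) : Ent (fun k => A (f k)) fun k => B (f k) := by
  obtain ⟨n, hn⟩ := Ent.iff.1 h
  exact Ent.iff.2 ⟨n, fun i => hn (f i)⟩

/-- Uniform entailment by inclusion. -/
theorem Ent.mono (h : Ent G A) (hAB : ∀ i, A i ⊆ B i) : Ent G B :=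
  h.trans (Ent.of_computable Computable.id fun i _ hm => hAB i hm)

/-- Use of a valid closed truth value. -/
theorem Ent.ax {φ : Set ℕ} (h : Valid φ) (hA : ∀ i, φ ⊆ A i) : Ent G A := by
  obtain ⟨n, hn⟩ := h
  exact Ent.of_computable (Computable.const n) fun i _ _ => hA i hn

theorem Ent.valid {φ : Set ℕ} (h : Ent (fun _ : Unit => Set.univ) fun _ => φ) : Valid φ := by
  obtain ⟨n, hn⟩ := Ent.iff.1 h
  obtain ⟨k, -, hk⟩ := hn () 0 trivial
  exact ⟨k, hk⟩

theorem Ent.ex {A : ι → κ → Set ℕ} (j : ι → κ) (h : Ent G fun i => A i (j i)) :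
    Ent G fun i => ⋃ k, A i k :=
  h.mono fun i => Set.subset_iUnion (A i) (j i)

theorem Ent.exElim {A : ι → κ → Set ℕ} (h : Ent G fun i => ⋃ k, A i k)
    (h' : Ent (fun p : ι × κ => G p.1 ∧ʳ A p.1 p.2) fun p => C p.1) : Ent G C := by
  obtain ⟨n, hn⟩ := Ent.iff.1 h'
  refine ((Ent.refl G).and h).trans (Ent.iff.2 ⟨n, ?_⟩)
  rintro i m ⟨hm, hm'⟩
  obtain ⟨k, hk⟩ := Set.mem_iUnion.1 hm'
  exact hn (i, k) m ⟨hm, hk⟩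

theorem Ent.all {A : ι → κ → Set ℕ}
    (h : Ent (fun p : ι × κ => G p.1) fun p => A p.1 p.2) : Ent G fun i => ⋂ k, A i k := by
  obtain hκ | ⟨⟨k₀⟩⟩ := isEmpty_or_nonempty κ
  · exact Ent.of_computable Computable.id fun i m _ => by simp
  obtain ⟨n, hn⟩ := Ent.iff.1 h
  refine Ent.iff.2 ⟨n, fun i m hm => ?_⟩
  obtain ⟨a, ha, -⟩ := hn (i, k₀) m hm
  refine ⟨a, ha, Set.mem_iInter.2 fun k => ?_⟩
  obtain ⟨b, hb, hb'⟩ := hn (i, k) m hm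
  rwa [Part.mem_unique ha hb]

theorem Ent.allElim {A : ι → κ → Set ℕ} (h : Ent G fun i => ⋂ k, A i k) (j : ι → κ) :
    Ent G fun i => A i (j i) :=
  h.mono fun i => Set.iInter_subset (A i) (j i)

end Rules

/-! ### Objects and morphisms of the effective topos -/

/-- An object of the effective topos: a set with a symmetric and transitive non-standard equality
predicate. -/
structure Eff : Type (u + 1) where
  carrier : Type u
  eq : carrier → carrier → Set ℕ
  symm : Valid (⋂ x, ⋂ y, (eq x y ⇒ʳ eq y x))
  trans : Valid (⋂ x, ⋂ y, ⋂ z, (eq x y ∧ʳ eq y z ⇒ʳ eq x z))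

namespace Eff

/-- The existence predicate. -/
def E (X : Eff.{u}) (x : X.carrier) : Set ℕ := X.eq x x

/-- Interpretation of the quantifier `∀ x ∈ X`. -/
def all (X : Eff.{u}) (φ : X.carrier → Set ℕ) : Set ℕ := ⋂ x, (X.E x ⇒ʳ φ x)

/-- Interpretation of the quantifier `∃ x ∈ X`. -/
def ex (X : Eff.{u}) (φ : X.carrier → Set ℕ) : Set ℕ := ⋃ x, (X.E x ∧ʳ φ x)

section Rules

variable {ι : Type*} {G : ι → Set ℕ}

theorem ent_symm (X : Eff.{u}) {x y : ι → X.carrier} (h : Ent G fun i => X.eq (x i) (y i)) :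
    Ent G fun i => X.eq (y i) (x i) :=
  Ent.mp (Ent.ax X.symm fun i =>
    (Set.iInter_subset _ (x i)).trans (Set.iInter_subset _ (y i))) h

theorem ent_trans (X : Eff.{u}) {x y z : ι → X.carrier} (h : Ent G fun i => X.eq (x i) (y i))
    (h' : Ent G fun i => X.eq (y i) (z i)) : Ent G fun i => X.eq (x i) (z i) :=
  Ent.mp (Ent.ax X.trans fun i =>
    ((Set.iInter_subset _ (x i)).trans (Set.iInter_subset _ (y i))).trans
      (Set.iInter_subset _ (z i))) (h.and h')

theorem ent_left (X : Eff.{u}) {x y : ι → X.carrier} (h : Ent G fun i => X.eq (x i) (y i)) :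
    Ent G fun i => X.E (x i) := X.ent_trans h (X.ent_symm h)

theorem ent_right (X : Eff.{u}) {x y : ι → X.carrier} (h : Ent G fun i => X.eq (x i) (y i)) :
    Ent G fun i => X.E (y i) := X.ent_trans (X.ent_symm h) h

theorem ent_all (X : Eff.{u}) {A : ι → X.carrier → Set ℕ}
    (h : Ent (fun p : ι × X.carrier => G p.1 ∧ʳ X.E p.2) fun p => A p.1 p.2) :
    Ent G fun i => X.all (A i) :=
  Ent.all h.imp

theorem ent_allElim (X : Eff.{u}) {A : ι → X.carrier → Set ℕ}
    (h : Ent G fun i => X.all (A i)) (j : ι → X.carrier) (hj : Ent G fun i => X.E (j i)) :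
    Ent G fun i => A i (j i) :=
  Ent.mp (Ent.allElim h j) hj

end Rules

/-- A functional relation `F` from `X` to `Y`. -/
structure FunRel (X Y : Eff.{u}) : Type u where
  rel : X.carrier → Y.carrier → Set ℕ
  strict : Valid (⋂ x, ⋂ y, (rel x y ⇒ʳ X.E x ∧ʳ Y.E y))
  ext : Valid (⋂ x', ⋂ x, ⋂ y, ⋂ y', (X.eq x' x ∧ʳ rel x y ∧ʳ Y.eq y y' ⇒ʳ rel x' y'))
  singleValued : Valid (⋂ x, ⋂ y, ⋂ y', (rel x y ∧ʳ rel x y' ⇒ʳ Y.eq y y'))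
  total : Valid (⋂ x, (X.E x ⇒ʳ Y.ex fun y => rel x y))

namespace FunRel

variable {X Y Z W : Eff.{u}}

section Rules

variable {ι : Type*} {G : ι → Set ℕ}

theorem ent_strict (F : FunRel X Y) {x : ι → X.carrier} {y : ι → Y.carrier}
    (h : Ent G fun i => F.rel (x i) (y i)) : Ent G fun i => X.E (x i) ∧ʳ Y.E (y i) :=
  Ent.mp (Ent.ax F.strict fun i =>
    (Set.iInter_subset _ (x i)).trans (Set.iInter_subset _ (y i))) h

theorem ent_ext (F : FunRel X Y) {x' x : ι → X.carrier} {y y' : ι → Y.carrier}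
    (hx : Ent G fun i => X.eq (x' i) (x i)) (h : Ent G fun i => F.rel (x i) (y i))
    (hy : Ent G fun i => Y.eq (y i) (y' i)) : Ent G fun i => F.rel (x' i) (y' i) :=
  Ent.mp (Ent.ax F.ext fun i =>
    (((Set.iInter_subset _ (x' i)).trans (Set.iInter_subset _ (x i))).trans
      (Set.iInter_subset _ (y i))).trans (Set.iInter_subset _ (y' i))) (hx.and (h.and hy))

theorem ent_sv (F : FunRel X Y) {x : ι → X.carrier} {y y' : ι → Y.carrier}
    (h : Ent G fun i => F.rel (x i) (y i)) (h' : Ent G fun i => F.rel (x i) (y' i)) :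
    Ent G fun i => Y.eq (y i) (y' i) :=
  Ent.mp (Ent.ax F.singleValued fun i =>
    ((Set.iInter_subset _ (x i)).trans (Set.iInter_subset _ (y i))).trans
      (Set.iInter_subset _ (y' i))) (h.and h')

theorem ent_total (F : FunRel X Y) {x : ι → X.carrier} (h : Ent G fun i => X.E (x i)) :
    Ent G fun i => ⋃ y, (Y.E y ∧ʳ F.rel (x i) y) :=
  Ent.mp (Ent.ax F.total fun i => Set.iInter_subset _ (x i)) h

end Rules

/-- Two functional relations represent the same morphism when they entail each other. -/
instance setoid (X Y : Eff.{u}) : Setoid (FunRel X Y) where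
  r F F' := Valid (⋂ x, ⋂ y, (F.rel x y ⇒ʳ F'.rel x y)) ∧
    Valid (⋂ x, ⋂ y, (F'.rel x y ⇒ʳ F.rel x y))
  iseqv :=
    have refl : ∀ F : FunRel X Y, Valid (⋂ x, ⋂ y, (F.rel x y ⇒ʳ F.rel x y)) := fun _ =>
      Ent.valid (Ent.all (Ent.all (Ent.imp (Ent.refl _).snd)))
    have trans : ∀ F F' F'' : FunRel X Y, Valid (⋂ x, ⋂ y, (F.rel x y ⇒ʳ F'.rel x y)) →
        Valid (⋂ x, ⋂ y, (F'.rel x y ⇒ʳ F''.rel x y)) →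
        Valid (⋂ x, ⋂ y, (F.rel x y ⇒ʳ F''.rel x y)) := fun _ _ _ h h' =>
      Ent.valid (Ent.all (Ent.all (Ent.imp
        (Ent.mp (Ent.ax h' fun p => (Set.iInter_subset _ p.1.2).trans (Set.iInter_subset _ p.2))
          (Ent.mp (Ent.ax h fun p => (Set.iInter_subset _ p.1.2).trans (Set.iInter_subset _ p.2))
            (Ent.refl _).snd)))))
    { refl := fun F => ⟨refl F, refl F⟩
      symm := fun h => ⟨h.2, h.1⟩
      trans := fun h h' => ⟨trans _ _ _ h.1 h'.1, trans _ _ _ h'.2 h.2⟩ }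

theorem ent_of_le {ι : Type*} {G : ι → Set ℕ} {F F' : FunRel X Y}
    (h : Valid (⋂ x, ⋂ y, (F.rel x y ⇒ʳ F'.rel x y))) {x : ι → X.carrier} {y : ι → Y.carrier}
    (hF : Ent G fun i => F.rel (x i) (y i)) : Ent G fun i => F'.rel (x i) (y i) :=
  Ent.mp (Ent.ax h fun i => (Set.iInter_subset _ (x i)).trans (Set.iInter_subset _ (y i))) hF

theorem le_of_ent {F F' : FunRel X Y}
    (h : Ent (fun p : (Unit × X.carrier) × Y.carrier => F.rel p.1.2 p.2)
      fun p => F'.rel p.1.2 p.2) :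
    Valid (⋂ x, ⋂ y, (F.rel x y ⇒ʳ F'.rel x y)) :=
  Ent.valid (Ent.all (Ent.all (Ent.imp ((Ent.refl _).snd.trans h))))

/-- Two functional relations represent the same morphism as soon as one entails the other. -/
theorem equiv_of_ent {F F' : FunRel X Y}
    (h : Ent (fun p : (Unit × X.carrier) × Y.carrier => F.rel p.1.2 p.2)
      fun p => F'.rel p.1.2 p.2) : F ≈ F' := by
  have h1 := le_of_ent h
  refine ⟨h1, le_of_ent ?_⟩
  have hyp := Ent.refl fun p : (Unit × X.carrier) × Y.carrier => F'.rel p.1.2 p.2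
  have hE := (F'.ent_strict hyp).fst
  refine Ent.exElim (F.ent_total hE) ?_
  have hF' := (Ent.refl fun p : ((Unit × X.carrier) × Y.carrier) × Y.carrier =>
    F'.rel p.1.1.2 p.1.2 ∧ʳ Y.E p.2 ∧ʳ F.rel p.1.1.2 p.2)
  have hF := hF'.snd.snd
  have e := F'.ent_sv (ent_of_le h1 hF) hF'.fst
  exact F.ent_ext (F.ent_strict hF).fst hF e

/-- The identity, represented by the equality predicate. -/
def id (X : Eff.{u}) : FunRel X X where
  rel := X.eq
  strict := Ent.valid <| Ent.all <| Ent.all <| Ent.imp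
    ((X.ent_left (Ent.refl _).snd).and (X.ent_right (Ent.refl _).snd))
  ext := Ent.valid <| Ent.all <| Ent.all <| Ent.all <| Ent.all <| Ent.imp
    (X.ent_trans (Ent.refl _).snd.fst
      (X.ent_trans (Ent.refl _).snd.snd.fst (Ent.refl _).snd.snd.snd))
  singleValued := Ent.valid <| Ent.all <| Ent.all <| Ent.all <| Ent.imp
    (X.ent_trans (X.ent_symm (Ent.refl _).snd.fst) (Ent.refl _).snd.snd)
  total := Ent.valid <| Ent.all <| Ent.imp <| Ent.ex (fun p => p.2)
    ((Ent.refl _).snd.and (Ent.refl _).snd)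

/-- Composition: `(G ∘ F)(x, z) = ⋃ y, F(x, y) ∧ G(y, z)`. -/
def comp (F : FunRel X Y) (K : FunRel Y Z) : FunRel X Z where
  rel x z := ⋃ y, (F.rel x y ∧ʳ K.rel y z)
  strict := Ent.valid <| Ent.all <| Ent.all <| Ent.imp <| Ent.exElim (Ent.refl _).snd
    ((F.ent_strict (Ent.refl _).snd.fst).fst.and (K.ent_strict (Ent.refl _).snd.snd).snd)
  ext := Ent.valid <| Ent.all <| Ent.all <| Ent.all <| Ent.all <| Ent.imp <|
    Ent.exElim (Ent.refl _).snd.snd.fst <| by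
      have h := (Ent.refl fun p : (((((Unit × X.carrier) × X.carrier) × Z.carrier) × Z.carrier) ×
        Y.carrier) => (Set.univ ∧ʳ X.eq p.1.1.1.1.2 p.1.1.1.2 ∧ʳ
          (⋃ y, (F.rel p.1.1.1.2 y ∧ʳ K.rel y p.1.1.2)) ∧ʳ Z.eq p.1.1.2 p.1.2) ∧ʳ
            F.rel p.1.1.1.2 p.2 ∧ʳ K.rel p.2 p.1.1.2)
      have hy := (F.ent_strict h.snd.fst).snd
      exact Ent.ex (fun p => p.2) ((F.ent_ext h.fst.snd.fst h.snd.fst hy).and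
        (K.ent_ext hy h.snd.snd h.fst.snd.snd.snd))
  singleValued := Ent.valid <| Ent.all <| Ent.all <| Ent.all <| Ent.imp <|
    Ent.exElim (Ent.refl _).snd.fst <| Ent.exElim (Ent.refl _).fst.snd.snd <| by
      have h := (Ent.refl fun p : ((((Unit × X.carrier) × Z.carrier) × Z.carrier) ×
        Y.carrier) × Y.carrier => ((Set.univ ∧ʳ (⋃ y, (F.rel p.1.1.1.1.2 y ∧ʳ K.rel y p.1.1.1.2)) ∧ʳ
          (⋃ y, (F.rel p.1.1.1.1.2 y ∧ʳ K.rel y p.1.1.2))) ∧ʳ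
            F.rel p.1.1.1.1.2 p.1.2 ∧ʳ K.rel p.1.2 p.1.1.1.2) ∧ʳ
            F.rel p.1.1.1.1.2 p.2 ∧ʳ K.rel p.2 p.1.1.2)
      have e := F.ent_sv h.fst.snd.fst h.snd.fst
      have hz := (K.ent_strict h.snd.snd).snd
      exact K.ent_sv h.fst.snd.snd (K.ent_ext e h.snd.snd hz)
  total := Ent.valid <| Ent.all <| Ent.imp <|
    Ent.exElim (F.ent_total (Ent.refl _).snd) <|
    Ent.exElim (K.ent_total (Ent.refl _).snd.fst) <| by
      have h := (Ent.refl fun p : ((Unit × X.carrier) × Y.carrier) × Z.carrier =>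
        ((Set.univ ∧ʳ X.E p.1.1.2) ∧ʳ Y.E p.1.2 ∧ʳ F.rel p.1.1.2 p.1.2) ∧ʳ
          Z.E p.2 ∧ʳ K.rel p.1.2 p.2)
      exact Ent.ex (fun p => p.2) (h.snd.fst.and (Ent.ex (fun p => p.1.2)
        (h.fst.snd.snd.and h.snd.snd)))

theorem comp_congr {F F' : FunRel X Y} {K K' : FunRel Y Z} (hF : F ≈ F') (hK : K ≈ K') :
    F.comp K ≈ F'.comp K' :=
  equiv_of_ent <| Ent.exElim (Ent.refl _) <| Ent.ex (fun p => p.2)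
    ((ent_of_le hF.1 (Ent.refl _).snd.fst).and (ent_of_le hK.1 (Ent.refl _).snd.snd))

end FunRel

/-- The effective topos. -/
instance category : Category.{u} Eff.{u} where
  Hom X Y := Quotient (FunRel.setoid X Y)
  id X := ⟦FunRel.id X⟧
  comp := Quotient.map₂ FunRel.comp fun _ _ h _ _ h' => FunRel.comp_congr h h'
  id_comp := by
    rintro X Y ⟨F⟩
    refine Quotient.sound (FunRel.equiv_of_ent (Ent.exElim (Ent.refl _) ?_))
    exact F.ent_ext (Ent.refl _).snd.fst (Ent.refl _).snd.snd
      (F.ent_strict (Ent.refl _).snd.snd).snd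
  comp_id := by
    rintro X Y ⟨F⟩
    refine Quotient.sound (FunRel.equiv_of_ent (Ent.exElim (Ent.refl _) ?_))
    exact F.ent_ext (F.ent_strict (Ent.refl _).snd.fst).fst (Ent.refl _).snd.fst
      (Ent.refl _).snd.snd
  assoc := by
    rintro X Y Z W ⟨F⟩ ⟨K⟩ ⟨L⟩
    refine Quotient.sound (FunRel.equiv_of_ent (Ent.exElim (Ent.refl _)
      (Ent.exElim (Ent.refl _).snd.fst ?_)))
    exact Ent.ex (fun p => p.2) ((Ent.refl _).snd.fst.and
      (Ent.ex (fun p => p.1.2) ((Ent.refl _).snd.snd.and (Ent.refl _).fst.snd.snd)))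

/-- The morphism represented by a functional relation. -/
def FunRel.hom {X Y : Eff.{u}} (F : FunRel X Y) : X ⟶ Y := Quotient.mk _ F

/-- `F` represents the morphism `f`. -/
def Represents {X Y : Eff.{u}} (F : FunRel X Y) (f : X ⟶ Y) : Prop := F.hom = f

/-! ### Subobjects and powerobjects -/

/-- The subobject `{x ∈ X | φ(x)}` of `X` given by an extensional predicate. -/
def sep (X : Eff.{u}) (φ : X.carrier → Set ℕ)
    (hφ : Valid (⋂ x, ⋂ y, (φ x ∧ʳ X.eq x y ⇒ʳ φ y))) : Eff.{u} where
  carrier := X.carrier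
  eq x y := X.eq x y ∧ʳ φ x
  symm := Ent.valid <| Ent.all <| Ent.all <| Ent.imp <|
    (X.ent_symm (Ent.refl _).snd.fst).and <|
      Ent.mp (Ent.ax hφ fun p => (Set.iInter_subset _ p.1.2).trans (Set.iInter_subset _ p.2))
        ((Ent.refl _).snd.snd.and (Ent.refl _).snd.fst)
  trans := Ent.valid <| Ent.all <| Ent.all <| Ent.all <| Ent.imp <|
    (X.ent_trans (Ent.refl _).snd.fst.fst (Ent.refl _).snd.snd.fst).and (Ent.refl _).snd.fst.snd

/-- The inclusion `{x ∈ X | φ(x)} ⟶ X`. -/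
def sepIncl (X : Eff.{u}) (φ : X.carrier → Set ℕ)
    (hφ : Valid (⋂ x, ⋂ y, (φ x ∧ʳ X.eq x y ⇒ʳ φ y))) : X.sep φ hφ ⟶ X :=
  FunRel.hom
    { rel := (X.sep φ hφ).eq
      strict := Ent.valid <| Ent.all <| Ent.all <| Ent.imp <|
        ((X.sep φ hφ).ent_left (Ent.refl _).snd).and (X.ent_right (Ent.refl _).snd.fst)
      ext := Ent.valid <| Ent.all <| Ent.all <| Ent.all <| Ent.all <| Ent.imp <|
        (X.ent_trans (Ent.refl _).snd.fst.fst
          (X.ent_trans (Ent.refl _).snd.snd.fst.fst (Ent.refl _).snd.snd.snd)).and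
            (Ent.refl _).snd.fst.snd
      singleValued := Ent.valid <| Ent.all <| Ent.all <| Ent.all <| Ent.imp
        (X.ent_trans (X.ent_symm (Ent.refl _).snd.fst.fst) (Ent.refl _).snd.snd.fst)
      total := Ent.valid <| Ent.all <| Ent.imp <| Ent.ex (fun p => p.2)
        ((Ent.refl _).snd.fst.and (Ent.refl _).snd) }

/-- Interpretation of `A ⊆ B`, that is, of `∀ x, A(x) ⇒ B(x)`, for non-standard predicates. -/
def sub (X : Eff.{u}) (A B : X.carrier → Set ℕ) : Set ℕ := ⋂ x, (A x ⇒ʳ B x)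

/-- The truth value of: `A` is strict. -/
def strictPred (X : Eff.{u}) (A : X.carrier → Set ℕ) : Set ℕ := ⋂ x, (A x ⇒ʳ X.E x)

/-- The truth value of: `A` is extensional. -/
def extPred (X : Eff.{u}) (A : X.carrier → Set ℕ) : Set ℕ :=
  ⋂ x, ⋂ y, (A x ∧ʳ X.eq x y ⇒ʳ A y)

section Rules

variable (X : Eff.{u}) {ι : Type*} {G : ι → Set ℕ} {A B C : ι → X.carrier → Set ℕ}

theorem ent_subElim (h : Ent G fun i => X.sub (A i) (B i)) {x : ι → X.carrier}
    (hx : Ent G fun i => A i (x i)) : Ent G fun i => B i (x i) :=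
  Ent.mp (Ent.allElim h x) hx

theorem ent_subTrans (h : Ent G fun i => X.sub (A i) (B i))
    (h' : Ent G fun i => X.sub (B i) (C i)) : Ent G fun i => X.sub (A i) (C i) := by
  refine Ent.trans (h.and h') (Ent.all (Ent.imp ?_))
  have hyp := Ent.refl fun p : ι × X.carrier =>
    (X.sub (A p.1) (B p.1) ∧ʳ X.sub (B p.1) (C p.1)) ∧ʳ A p.1 p.2
  exact X.ent_subElim hyp.fst.snd (X.ent_subElim hyp.fst.fst hyp.snd)

theorem ent_strictPred (h : Ent G fun i => X.sub (B i) (A i))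
    (hA : Ent G fun i => X.strictPred (A i)) : Ent G fun i => X.strictPred (B i) := by
  refine Ent.trans (h.and hA) (Ent.all (Ent.imp ?_))
  have hyp := Ent.refl fun p : ι × X.carrier =>
    (X.sub (B p.1) (A p.1) ∧ʳ X.strictPred (A p.1)) ∧ʳ B p.1 p.2
  exact Ent.mp (Ent.allElim hyp.fst.snd fun p => p.2) (X.ent_subElim hyp.fst.fst hyp.snd)

theorem ent_extPred (h : Ent G fun i => X.sub (A i) (B i)) (h' : Ent G fun i => X.sub (B i) (A i))
    (hA : Ent G fun i => X.extPred (A i)) : Ent G fun i => X.extPred (B i) := by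
  refine Ent.trans (h.and (h'.and hA)) (Ent.all (Ent.all (Ent.imp ?_)))
  have hyp := Ent.refl fun p : (ι × X.carrier) × X.carrier =>
    (X.sub (A p.1.1) (B p.1.1) ∧ʳ X.sub (B p.1.1) (A p.1.1) ∧ʳ X.extPred (A p.1.1)) ∧ʳ
      B p.1.1 p.1.2 ∧ʳ X.eq p.1.2 p.2
  exact X.ent_subElim hyp.fst.fst (Ent.mp
    (Ent.allElim (Ent.allElim hyp.fst.snd.snd fun p => p.1.2) fun p => p.2)
    ((X.ent_subElim hyp.fst.snd.fst hyp.snd.fst).and hyp.snd.snd))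

end Rules

/-- The powerobject of `X`. -/
def pow (X : Eff.{u}) : Eff.{u} where
  carrier := X.carrier → Set ℕ
  eq A B := X.sub A B ∧ʳ X.sub B A ∧ʳ X.strictPred A ∧ʳ X.extPred A
  symm := Ent.valid <| Ent.all <| Ent.all <| Ent.imp <| by
    have h := (Ent.refl fun p : (Unit × (X.carrier → Set ℕ)) × (X.carrier → Set ℕ) =>
      Set.univ ∧ʳ X.sub p.1.2 p.2 ∧ʳ X.sub p.2 p.1.2 ∧ʳ X.strictPred p.1.2 ∧ʳ
        X.extPred p.1.2).snd
    exact h.snd.fst.and (h.fst.and ((X.ent_strictPred h.snd.fst h.snd.snd.fst).and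
      (X.ent_extPred h.fst h.snd.fst h.snd.snd.snd)))
  trans := Ent.valid <| Ent.all <| Ent.all <| Ent.all <| Ent.imp <|
    (X.ent_subTrans (Ent.refl _).snd.fst.fst (Ent.refl _).snd.snd.fst).and <|
    (X.ent_subTrans (Ent.refl _).snd.snd.snd.fst (Ent.refl _).snd.fst.snd.fst).and
    (Ent.refl _).snd.fst.snd.snd

/-- The interpretation of `x ∈ A`, for variables `x` of type `X` and `A` of type `pow X`. -/
def mem (X : Eff.{u}) (x : X.carrier) (A : X.carrier → Set ℕ) : Set ℕ :=
  X.E x ∧ʳ X.pow.E A ∧ʳ A x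

theorem ent_mem_of_eq (X : Eff.{u}) {ι : Type*} {G : ι → Set ℕ} {x : ι → X.carrier}
    {A B : ι → X.carrier → Set ℕ} (h : Ent G fun i => X.mem (x i) (A i))
    (e : Ent G fun i => X.pow.eq (A i) (B i)) : Ent G fun i => X.mem (x i) (B i) :=
  h.fst.and ((X.pow.ent_right e).and (X.ent_subElim e.fst h.snd.snd))

/-! ### Internal order theory -/

/-- A binary relation on `X` in the effective topos, that is, a strict extensional predicate
on `X × X`. -/
structure Rel (X : Eff.{u}) : Type u where
  rel : X.carrier → X.carrier → Set ℕ
  strict : Valid (⋂ x, ⋂ y, (rel x y ⇒ʳ X.E x ∧ʳ X.E y))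
  ext : Valid (⋂ x, ⋂ x', ⋂ y, ⋂ y', (rel x y ∧ʳ X.eq x x' ∧ʳ X.eq y y' ⇒ʳ rel x' y'))

section Order

variable {L : Eff.{u}} (R : L.Rel)

/-- `(L, R)` is a poset in the internal language. -/
structure IsPoset : Prop where
  refl : Valid (L.all fun x => R.rel x x)
  trans : Valid (L.all fun x => L.all fun y => L.all fun z =>
    (R.rel x y ∧ʳ R.rel y z ⇒ʳ R.rel x z))
  antisymm : Valid (L.all fun x => L.all fun y => (R.rel x y ∧ʳ R.rel y x ⇒ʳ L.eq x y))

/-- Interpretation of: `x` is an upper bound of `A`. -/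
def bound (x : L.carrier) (A : L.pow.carrier) : Set ℕ :=
  L.all fun y => (L.mem y A ⇒ʳ R.rel y x)

/-- Interpretation of: `z` is the supremum of `A`. -/
def isSup (z : L.carrier) (A : L.pow.carrier) : Set ℕ :=
  bound R z A ∧ʳ L.all fun y => (bound R y A ⇒ʳ R.rel z y)

/-- Interpretation of: `C` is a chain. -/
def isChain (C : L.pow.carrier) : Set ℕ :=
  L.all fun x => L.all fun y => (L.mem x C ∧ʳ L.mem y C ⇒ʳ R.rel x y ∨ʳ R.rel y x)

theorem isChain_ext :
    Valid (⋂ C, ⋂ C', (isChain R C ∧ʳ L.pow.eq C C' ⇒ʳ isChain R C')) :=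
  Ent.valid <| Ent.all <| Ent.all <| Ent.imp <| L.ent_all <| L.ent_all <| Ent.imp <| by
    have h := Ent.refl fun p : (((Unit × L.pow.carrier) × L.pow.carrier) × L.carrier) × L.carrier =>
      (((Set.univ ∧ʳ isChain R p.1.1.1.2 ∧ʳ L.pow.eq p.1.1.1.2 p.1.1.2) ∧ʳ L.E p.1.2) ∧ʳ
        L.E p.2) ∧ʳ L.mem p.1.2 p.1.1.2 ∧ʳ L.mem p.2 p.1.1.2
    have e := L.pow.ent_symm h.fst.fst.fst.snd.snd
    have hC := L.ent_allElim h.fst.fst.fst.snd.fst (fun p => p.1.2) h.fst.fst.snd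
    exact Ent.mp (L.ent_allElim hC (fun p => p.2) h.fst.snd)
      ((L.ent_mem_of_eq h.snd.fst e).and (L.ent_mem_of_eq h.snd.snd e))

/-- The object of chains of `(L, R)`. -/
def chains : Eff.{u} := L.pow.sep (isChain R) (isChain_ext R)

/-- The inclusion of the object of chains in the powerobject. -/
def chainsIncl : chains R ⟶ L.pow := L.pow.sepIncl (isChain R) (isChain_ext R)

/-- `(L, R)` is chain-complete in the internal language: every chain has a supremum. -/
def IsChainComplete : Prop :=
  Valid ((chains R).all fun C => L.ex fun z => isSup R z C)

/-- The morphism `s` is the supremum operator on chains: in the internal language, `s(C)` is the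
supremum of `C`, for all chains `C`. -/
def IsChainSup (s : chains R ⟶ L) : Prop :=
  ∀ F : FunRel (chains R) L, Represents F s →
    Valid ((chains R).all fun C => L.ex fun z => (F.rel C z ∧ʳ isSup R z C))

end Order

/-! ### Constant objects -/

open Classical in
/-- The truth value `ℕ` if `p` holds, and `∅` otherwise. -/
noncomputable def tprop (p : Prop) : Set ℕ := if p then Set.univ else ∅

theorem mem_tprop {p : Prop} {n : ℕ} : n ∈ tprop p ↔ p := by
  unfold tprop; split <;> simp_all

/-- The constant object `∇ S`. -/
noncomputable def nabla (S : Type u) : Eff.{u} where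
  carrier := S
  eq x y := tprop (x = y)
  symm := Ent.valid <| Ent.all <| Ent.all <| Ent.imp <| (Ent.refl _).snd.mono
    fun _ _ h => mem_tprop.2 (mem_tprop.1 h).symm
  trans := Ent.valid <| Ent.all <| Ent.all <| Ent.all <| Ent.imp <| (Ent.refl _).snd.trans <|
    Ent.of_computable Computable.id
      fun _ _ h => mem_tprop.2 ((mem_tprop.1 h.1).trans (mem_tprop.1 h.2))

/-- The morphism `X ⟶ ∇ T` that corresponds under the adjunction `Γ ⊣ ∇` to a map on global
points, given as a map `g` on the underlying set that sends elements with a realized equality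
to the same value. -/
noncomputable def toNabla (X : Eff.{u}) {T : Type u} (g : X.carrier → T)
    (hg : ∀ x y, Valid (X.eq x y) → g x = g y) : X ⟶ nabla T :=
  FunRel.hom
    { rel := fun x t => X.E x ∧ʳ (nabla T).eq (g x) t
      strict := Ent.valid <| Ent.all <| Ent.all <| Ent.imp <|
        (Ent.refl _).snd.fst.and ((nabla T).ent_right (Ent.refl _).snd.snd)
      ext := Ent.valid <| Ent.all <| Ent.all <| Ent.all <| Ent.all <| Ent.imp <|
        (X.ent_left (Ent.refl _).snd.fst).and <| ((Ent.refl _).snd).trans <|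
          Ent.of_computable Computable.id fun _ _ h => mem_tprop.2 <|
            (hg _ _ ⟨_, h.1⟩).trans ((mem_tprop.1 h.2.1.2).trans (mem_tprop.1 h.2.2))
      singleValued := Ent.valid <| Ent.all <| Ent.all <| Ent.all <| Ent.imp <|
        (nabla T).ent_trans ((nabla T).ent_symm (Ent.refl _).snd.fst.snd) (Ent.refl _).snd.snd.snd
      total := Ent.valid <| Ent.all <| Ent.imp <| Ent.ex (fun p => g p.2) <|
        have h := (Ent.refl _).mono fun _ _ _ => mem_tprop.2 rfl
        h.and ((Ent.refl _).snd.and h) }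

/-- The action of `∇` on maps: `(∇ f)(x, y) = [f(x) = y]`. -/
noncomputable def nablaMap {S T : Type u} (f : S → T) : nabla S ⟶ nabla T :=
  FunRel.hom
    { rel := fun x y => (nabla T).eq (f x) y
      strict := Ent.valid <| Ent.all <| Ent.all <| Ent.imp <|
        ((Ent.refl _).mono fun _ _ _ => mem_tprop.2 rfl).and
          ((nabla T).ent_right (Ent.refl _).snd)
      ext := Ent.valid <| Ent.all <| Ent.all <| Ent.all <| Ent.all <| Ent.imp <|
        ((Ent.refl _).snd).trans <| Ent.of_computable Computable.id fun _ _ h => mem_tprop.2 <|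
          (congrArg f (mem_tprop.1 h.1)).trans ((mem_tprop.1 h.2.1).trans (mem_tprop.1 h.2.2))
      singleValued := Ent.valid <| Ent.all <| Ent.all <| Ent.all <| Ent.imp <|
        (nabla T).ent_trans ((nabla T).ent_symm (Ent.refl _).snd.fst) (Ent.refl _).snd.snd
      total := Ent.valid <| Ent.all <| Ent.imp <| Ent.ex (fun p => f p.2) <|
        have h := (Ent.refl _).mono fun _ _ _ => mem_tprop.2 rfl
        h.and h }

/-- The relation `∇ r` on `∇ S` induced by a relation `r` on the set `S`. -/
noncomputable def nablaRel {S : Type u} (r : S → S → Prop) : (nabla S).Rel where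
  rel x y := tprop (r x y)
  strict := Ent.valid <| Ent.all <| Ent.all <| Ent.imp <|
    ((Ent.refl _).mono fun _ _ _ => mem_tprop.2 rfl).and
      ((Ent.refl _).mono fun _ _ _ => mem_tprop.2 rfl)
  ext := Ent.valid <| Ent.all <| Ent.all <| Ent.all <| Ent.all <| Ent.imp <|
    ((Ent.refl _).snd).trans <| Ent.of_computable Computable.id fun _ _ h => mem_tprop.2 <| by
      have h1 := mem_tprop.1 h.1
      rwa [mem_tprop.1 h.2.1, mem_tprop.1 h.2.2] at h1

theorem valid_tneg_tneg {A : Set ℕ} : Valid (tneg (tneg A)) ↔ A.Nonempty := by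
  simp only [Valid, tneg, timp, Set.Nonempty, Set.mem_empty_iff_false, and_false, exists_false]
  constructor
  · rintro ⟨n, hn⟩
    by_contra! h
    exact hn 0 fun m hm => h m hm
  · rintro ⟨m, hm⟩
    exact ⟨0, fun k hk => hk m hm⟩

/-- The `¬¬`-closure `P(∇ S) ⟶ ∇ (P S)`, which sends `A` to the set of those `x` for which
`¬¬ (x ∈ A)` is valid. -/
noncomputable def notNotClosure (S : Type u) : (nabla S).pow ⟶ nabla (Set S) :=
  (nabla S).pow.toNabla (fun A => {x | Valid (tneg (tneg (A x)))}) <| by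
    rintro A B ⟨n, hn⟩
    ext x
    have h1 := Set.mem_iInter.1 hn.1 x
    have h2 := Set.mem_iInter.1 hn.2.1 x
    simp only [Set.mem_ofPred_eq, valid_tneg_tneg]
    exact ⟨fun ⟨m, hm⟩ => (h1 m hm).imp fun _ h => h.2, fun ⟨m, hm⟩ => (h2 m hm).imp fun _ h => h.2⟩

/-- The set of countable subsets of `S`. -/
def CountableSubsets (S : Type u) : Type u := {A : Set S // A.Countable}

/-- The inclusion of the countable subsets among all subsets. -/
def CountableSubsets.incl {S : Type u} (A : CountableSubsets S) : Set S := A.1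

end Eff

/-! ### The countable ordinals -/

/-- The set of countable ordinals, with its usual linear order. -/
abbrev CountableOrdinal : Type (u + 1) := Set.Iio (Ordinal.omega.{u} 1)

/-- The supremum of a countable set of countable ordinals. -/
noncomputable def CountableOrdinal.sup (A : Eff.CountableSubsets CountableOrdinal.{u}) :
    CountableOrdinal.{u} :=
  ⟨sSup (Subtype.val '' A.1), by
    have : Countable A.1 := A.2.to_subtype
    rw [sSup_image', Set.mem_Iio]
    exact Ordinal.iSup_lt_omega_one fun a => a.1.2⟩

theorem CountableOrdinal.isLUB_sup (A : Eff.CountableSubsets CountableOrdinal.{u}) :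
    IsLUB A.1 (CountableOrdinal.sup A) := by
  have hb : BddAbove (Subtype.val '' A.1) :=
    ⟨Ordinal.omega 1, by rintro _ ⟨a, -, rfl⟩; exact a.2.le⟩
  exact ⟨fun a ha => le_csSup hb ⟨a, ha, rfl⟩, fun b hb' =>
    show sSup _ ≤ b.1 from csSup_le' (by rintro _ ⟨a, ha, rfl⟩; exact hb' ha)⟩

/-- The order on `∇ ω₁`, induced by the order of the countable ordinals. -/
noncomputable def nablaOmegaLE : (Eff.nabla CountableOrdinal.{u}).Rel :=
  Eff.nablaRel fun x y => x ≤ y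

end EffTopos

/-!
The internal statement that a non-standard subset `C` of `∇ S` is a chain is realized by one
program which decides, from a realizer `a` of `x ∈ C` and a realizer `b` of `y ∈ C`, which of
`x ≤ y` and `y ≤ x` holds. The elements `x`, `y` themselves are invisible to the program, since
every number realizes their existence. If the same number `a` realizes both `x ∈ C` and `y ∈ C`,
then the answers for `(x, y)` and for `(y, x)` are computed from the same input, hence are equal,
and so `x ≤ y` and `y ≤ x`. Thus a natural number realizes membership of at most one element in
`C`, and the support of `C`, which is its `¬¬`-closure, is countable: this is
`Eff.support_countable`.

Hence the `¬¬`-closure of chains factors through `∇` of the countable subsets, uniquely because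
`∇` of an injection is monic (`Eff.nablaMap_mono`). The supremum of the closure, which exists
since countable sets of countable ordinals are bounded, is the supremum of the chain in the
internal language as well: being an upper bound of `C` and being below another bound are families
of truth values that are `ℕ` or `∅`, so that they are realized uniformly as soon as they are true
(`Eff.ent_tprop`, `Eff.ent_isSup`).
-/

namespace EffTopos

namespace Eff

/-! ### Truth values without computational content -/

theorem pair_mem_tand {A B : Set ℕ} {m n : ℕ} (hm : m ∈ A) (hn : n ∈ B) :
    Nat.pair m n ∈ (A ∧ʳ B) := by
  simpa [tand] using And.intro hm hn

theorem mem_E_nabla {S : Type u} (x : S) (n : ℕ) : n ∈ (nabla S).E x := mem_tprop.2 rfl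

/-- An entailment into truth values that are `ℕ` or `∅` only has to hold pointwise. -/
theorem ent_tprop {ι : Type*} {G : ι → Set ℕ} {p : ι → Prop} (h : ∀ i, ∀ n ∈ G i, p i) :
    Ent G fun i => tprop (p i) :=
  (Ent.refl G).mono fun i n hn => mem_tprop.2 (h i n hn)

/-! ### Maps to constant objects -/

/-- `∇` of an injective map is a monomorphism. -/
theorem nablaMap_mono {S T : Type u} {f : S → T} (hf : Function.Injective f) :
    Mono (nablaMap f) where
  right_cancellation := by
    rintro X ⟨F⟩ ⟨F'⟩ h
    obtain ⟨M, hM, hrel⟩ : ∃ M : FunRel (nabla S) (nabla T), nablaMap f = M.hom ∧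
      M.rel = fun x y => tprop (f x = y) := ⟨_, rfl, rfl⟩
    rw [hM] at h
    have h : F.comp M ≈ F'.comp M := Quotient.exact h
    refine Quotient.sound (FunRel.equiv_of_ent ?_)
    have hF := Ent.refl fun p : (Unit × X.carrier) × S => F.rel p.1.2 p.2
    have hFM : Ent (fun p : (Unit × X.carrier) × S => F.rel p.1.2 p.2)
        fun p => (F.comp M).rel p.1.2 (f p.2) :=
      Ent.ex (fun p => p.2) (hF.and (by rw [hrel]; exact ent_tprop fun _ _ _ => rfl))
    refine Ent.exElim (FunRel.ent_of_le h.1 hFM) ?_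
    have h' := Ent.refl fun p : ((Unit × X.carrier) × S) × S =>
      F.rel p.1.1.2 p.1.2 ∧ʳ F'.rel p.1.1.2 p.2 ∧ʳ M.rel p.2 (f p.1.2)
    have hS : Ent (fun p : ((Unit × X.carrier) × S) × S =>
        F.rel p.1.1.2 p.1.2 ∧ʳ F'.rel p.1.1.2 p.2 ∧ʳ M.rel p.2 (f p.1.2))
        fun p => (nabla S).eq p.2 p.1.2 :=
      ent_tprop fun _ _ hn => hf (mem_tprop.1 (hrel ▸ hn.2.2))
    exact F'.ent_ext (F'.ent_strict h'.snd.fst).fst h'.snd.fst hS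

section ToNabla

variable {X : Eff.{u}} {S T : Type u}

/-- The functional relation defining `toNabla`. -/
theorem exists_rep_toNabla (g : X.carrier → T) (hg : ∀ x y, Valid (X.eq x y) → g x = g y) :
    ∃ K : FunRel X (nabla T), K.hom = X.toNabla g hg ∧
      K.rel = fun x t => X.E x ∧ʳ tprop (g x = t) :=
  ⟨_, rfl, rfl⟩

/-- A representative of the morphism induced by `g` relates `x` to `g x`. -/
theorem ent_rel_of_represents_toNabla {g : X.carrier → T}
    {hg : ∀ x y, Valid (X.eq x y) → g x = g y} {F : FunRel X (nabla T)}
    (hF : Represents F (X.toNabla g hg)) {ι : Type*} {G : ι → Set ℕ} {x : ι → X.carrier}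
    (hx : Ent G fun i => X.E (x i)) : Ent G fun i => F.rel (x i) (g (x i)) := by
  obtain ⟨K, hK, hrel⟩ := exists_rep_toNabla g hg
  have h : K ≈ F := Quotient.exact (hK.trans hF.symm)
  refine FunRel.ent_of_le h.1 (?_ : Ent G fun i => K.rel (x i) (g (x i)))
  rw [hrel]
  exact hx.and (ent_tprop fun _ _ _ => rfl)

/-- A morphism to a constant object is the one induced by `g` as soon as related pairs lie on the
graph of `g`. -/
theorem hom_eq_toNabla {g : X.carrier → T} {hg : ∀ x y, Valid (X.eq x y) → g x = g y}
    {F : FunRel X (nabla T)} (hF : ∀ x t, Valid (F.rel x t) → g x = t) :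
    F.hom = X.toNabla g hg := by
  obtain ⟨K, hK, hrel⟩ := exists_rep_toNabla g hg
  rw [← hK]
  refine Quotient.sound (FunRel.equiv_of_ent ?_)
  rw [hrel]
  exact (F.ent_strict (Ent.refl _)).fst.and (ent_tprop fun _ _ hn => hF _ _ ⟨_, hn⟩)

theorem toNabla_comp_nablaMap {g : X.carrier → S} {hg : ∀ x y, Valid (X.eq x y) → g x = g y}
    (f : S → T) :
    X.toNabla g hg ≫ nablaMap f = X.toNabla (fun x => f (g x)) fun x y h => by rw [hg x y h] := by
  obtain ⟨K, hK, hrel⟩ := exists_rep_toNabla g hg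
  obtain ⟨M, hM, hrelM⟩ : ∃ M : FunRel (nabla S) (nabla T), nablaMap f = M.hom ∧
    M.rel = fun x y => tprop (f x = y) := ⟨_, rfl, rfl⟩
  rw [← hK, hM]
  refine hom_eq_toNabla (F := K.comp M) ?_
  rintro x t ⟨n, hn⟩
  obtain ⟨s, hs, hs'⟩ := Set.mem_iUnion.1 hn
  rw [hrel] at hs
  rw [hrelM] at hs'
  rw [mem_tprop.1 hs.2, mem_tprop.1 hs']

theorem sepIncl_comp_toNabla {φ : X.carrier → Set ℕ}
    {hφ : Valid (⋂ x, ⋂ y, (φ x ∧ʳ X.eq x y ⇒ʳ φ y))}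
    {g : X.carrier → T} {hg : ∀ x y, Valid (X.eq x y) → g x = g y} :
    X.sepIncl φ hφ ≫ X.toNabla g hg =
      (X.sep φ hφ).toNabla g fun x y h => hg x y (h.elim fun _ hn => ⟨_, hn.1⟩) := by
  obtain ⟨K, hK, hrel⟩ := exists_rep_toNabla g hg
  obtain ⟨M, hM, hrelM⟩ : ∃ M : FunRel (X.sep φ hφ) X, X.sepIncl φ hφ = M.hom ∧
    M.rel = fun x y => X.eq x y ∧ʳ φ x := ⟨_, rfl, rfl⟩
  rw [← hK, hM]
  refine hom_eq_toNabla (F := M.comp K) ?_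
  rintro x t ⟨n, hn⟩
  obtain ⟨y, hy, hy'⟩ := Set.mem_iUnion.1 hn
  rw [hrelM] at hy
  rw [hrel] at hy'
  rw [hg x y ⟨_, hy.1⟩, mem_tprop.1 hy'.2]

theorem toNabla_congr {g g' : X.carrier → T} {hg : ∀ x y, Valid (X.eq x y) → g x = g y}
    {hg' : ∀ x y, Valid (X.eq x y) → g' x = g' y} (h : ∀ x, Valid (X.E x) → g x = g' x) :
    X.toNabla g hg = X.toNabla g' hg' := by
  obtain ⟨K, hK, hrel⟩ := exists_rep_toNabla g hg
  rw [← hK]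
  refine hom_eq_toNabla ?_
  rintro x t ⟨n, hn⟩
  rw [hrel] at hn
  rw [← h x ⟨_, hn.1⟩, mem_tprop.1 hn.2]

end ToNabla

/-! ### Chains in constant posets -/

section Chains

variable {S : Type u}

/-- The relation `∇ ≤` on `∇ S`. -/
noncomputable abbrev leRel (S : Type u) [LE S] : (nabla S).Rel := nablaRel fun x y : S => x ≤ y

/-- The support of a non-standard subset of `∇ S`, that is, its `¬¬`-closure. -/
def support (C : S → Set ℕ) : Set S := {x | (C x).Nonempty}

theorem support_eq_of_valid {C D : (nabla S).pow.carrier} (h : Valid ((nabla S).pow.eq C D)) :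
    support C = support D := by
  obtain ⟨n, hn⟩ := h
  ext x
  exact ⟨fun ⟨m, hm⟩ => (Set.mem_iInter.1 hn.1 x m hm).imp fun _ h => h.2,
    fun ⟨m, hm⟩ => (Set.mem_iInter.1 hn.2.1 x m hm).imp fun _ h => h.2⟩

/-- A chain in `∇ S` has countable support, since a number realizes membership of at most one
element. -/
theorem support_countable [PartialOrder S] {C : (nabla S).pow.carrier}
    (hC : Valid ((chains (leRel S)).E C)) : (support C).Countable := by
  obtain ⟨n, ⟨hE, hchain⟩⟩ := hC
  set e := n.unpair.1
  choose! a ha using fun (x : S) (hx : x ∈ support C) => hx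
  refine Set.countable_iff_exists_injOn.2 ⟨a, fun (x : S) hx (y : S) hy hxy => ?_⟩
  -- Every number realizes existence in `∇ S`, so the pairs `(x, y)` and `(y, x)` give one input.
  have hmem : ∀ z : S, z ∈ support C →
      Nat.pair 0 (Nat.pair e (a z)) ∈ (nabla S).mem z C := fun z hz =>
    pair_mem_tand (mem_E_nabla z 0) (pair_mem_tand hE (ha z hz))
  have key : ∀ z : S, z ∈ support C → ∀ w : S, w ∈ support C →
      ∃ k ∈ app n.unpair.2 0, ∃ l ∈ app k 0,
      ∃ q ∈ app l (Nat.pair (Nat.pair 0 (Nat.pair e (a z))) (Nat.pair 0 (Nat.pair e (a w)))),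
        q ∈ (tprop (z ≤ w) ∨ʳ tprop (w ≤ z)) := fun z hz w hw => by
    obtain ⟨k, hk, hk'⟩ := Set.mem_iInter.1 hchain z 0 (mem_tprop.2 rfl)
    obtain ⟨l, hl, hl'⟩ := Set.mem_iInter.1 hk' w 0 (mem_tprop.2 rfl)
    exact ⟨k, hk, l, hl, hl' _ (pair_mem_tand (hmem z hz) (hmem w hw))⟩
  obtain ⟨k, hk, l, hl, r, hr, h⟩ := key x hx y hy
  obtain ⟨k', hk', l', hl', r', hr', h'⟩ := key y hy x hx
  obtain rfl := Part.mem_unique hk hk'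
  obtain rfl := Part.mem_unique hl hl'
  rw [hxy] at hr hr'
  obtain rfl := Part.mem_unique hr hr'
  -- Both answers carry the same tag `0` or `1`, so that `x ≤ y` and `y ≤ x` are both asserted.
  rcases h with ⟨h0, h⟩ | ⟨h0, h⟩ <;> rcases h' with ⟨h0', h'⟩ | ⟨h0', h'⟩
  · exact le_antisymm (α := S) (mem_tprop.1 h) (mem_tprop.1 h')
  · omega
  · omega
  · exact le_antisymm (α := S) (mem_tprop.1 h') (mem_tprop.1 h)

/-- The least upper bound of the support is the supremum in the internal language. -/
theorem ent_isSup [Preorder S] {ι : Type*} {G : ι → Set ℕ}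
    {C : ι → (nabla S).pow.carrier} {z : ι → S} (hC : ∀ i, ∀ n ∈ G i,
      Valid ((nabla S).pow.E (C i)) ∧ IsLUB (support (S := S) (C i)) (z i)) :
    Ent G fun i => isSup (leRel S) (z i) (C i) := by
  refine Ent.and ((nabla S).ent_all (Ent.imp (ent_tprop ?_)))
    ((nabla S).ent_all (Ent.imp (ent_tprop ?_)))
  · rintro ⟨i, x⟩ n hn
    exact (hC i _ hn.1.1).2.1 ⟨_, hn.2.2.2⟩
  · rintro ⟨i, y⟩ n hn
    obtain ⟨⟨e, he⟩, hlub⟩ := hC i _ hn.1.1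
    refine hlub.2 fun (x : S) ⟨a, ha⟩ => ?_
    obtain ⟨k, -, hk⟩ := Set.mem_iInter.1 hn.2 x 0 (mem_tprop.2 rfl)
    obtain ⟨l, -, hl⟩ := hk (Nat.pair 0 (Nat.pair e a))
      (pair_mem_tand (mem_E_nabla x 0) (pair_mem_tand he ha))
    exact mem_tprop.1 hl

theorem isPoset_nablaRel [PartialOrder S] : IsPoset (leRel S) where
  refl := Ent.valid <| (nabla S).ent_all <| ent_tprop fun _ _ _ => le_refl (α := S) _
  trans := Ent.valid <| (nabla S).ent_all <| (nabla S).ent_all <| (nabla S).ent_all <| Ent.imp <|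
    ent_tprop fun _ _ hn => le_trans (α := S) (mem_tprop.1 hn.2.1) (mem_tprop.1 hn.2.2)
  antisymm := Ent.valid <| (nabla S).ent_all <| (nabla S).ent_all <| Ent.imp <|
    ent_tprop fun _ _ hn => le_antisymm (α := S) (mem_tprop.1 hn.2.1) (mem_tprop.1 hn.2.2)

/-- A supremum operator on chains witnesses chain-completeness. -/
theorem IsChainSup.isChainComplete {L : Eff.{u}} {R : L.Rel} {s : chains R ⟶ L}
    (h : IsChainSup R s) : IsChainComplete R := by
  obtain ⟨F, hF⟩ := Quotient.exists_rep s
  have hv := h F hF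
  refine Ent.valid <| Ent.all <| Ent.imp ?_
  refine Ent.exElim (Ent.mp (Ent.ax hv fun p => Set.iInter_subset _ p.2) (Ent.refl _).snd) ?_
  exact Ent.ex (fun p => p.2) ((Ent.refl _).snd.fst.and (Ent.refl _).snd.snd.snd)

open Classical in
/-- The support as a countable subset; the value `∅` for uncountable supports is irrelevant, since
chains for `∇` of a partial order have countable support. -/
noncomputable def countableSupport (C : S → Set ℕ) : CountableSubsets S :=
  if h : (support C).Countable then ⟨support C, h⟩ else ⟨∅, Set.countable_empty⟩

theorem incl_countableSupport {C : S → Set ℕ} (h : (support C).Countable) :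
    (countableSupport C).incl = support C := by
  have h' : countableSupport C = ⟨support C, h⟩ := dif_pos h
  rw [h']
  rfl

theorem valid_pow_of_valid_chains {R : (nabla S).Rel} {C D : (nabla S).pow.carrier}
    (h : Valid ((chains R).eq C D)) : Valid ((nabla S).pow.eq C D) :=
  h.elim fun _ hn => ⟨_, hn.1⟩

/-- The morphism that sends `C` to its support as a countable subset. It is the `¬¬`-closure when
`R` is `∇` of a partial order. -/
noncomputable def chainClosure (R : (nabla S).Rel) : chains R ⟶ nabla (CountableSubsets S) :=
  (chains R).toNabla countableSupport fun C D h => by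
    have h := support_eq_of_valid (valid_pow_of_valid_chains h)
    by_cases hC : (support C).Countable
    · exact Subtype.ext ((incl_countableSupport hC).trans
        (h.trans (incl_countableSupport (h ▸ hC)).symm))
    · have hD : ¬(support D).Countable := h ▸ hC
      exact (dif_neg hC : countableSupport C = _).trans (dif_neg hD : countableSupport D = _).symm

theorem chainClosure_comp_incl [PartialOrder S] :
    chainClosure (leRel S) ≫ nablaMap CountableSubsets.incl =
      chainsIncl (leRel S) ≫ notNotClosure S := by
  refine toNabla_comp_nablaMap _ |>.trans (.trans (toNabla_congr fun C hC => ?_)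
    sepIncl_comp_toNabla.symm)
  simp only [valid_tneg_tneg]
  exact incl_countableSupport (support_countable hC)

/-- A map that sends countable subsets to their suprema induces the supremum operator on
chains. -/
theorem isChainSup_chainClosure [PartialOrder S] {f : CountableSubsets S → S}
    (hf : ∀ A : CountableSubsets S, IsLUB A.1 (f A)) :
    IsChainSup (leRel S) (chainClosure (leRel S) ≫ nablaMap f) := by
  intro F hF
  have hlub : ∀ C : S → Set ℕ, (support C).Countable →
      IsLUB (support C) (f (countableSupport C)) := fun C hC => by
    rw [← incl_countableSupport hC]
    exact hf _
  have hF := Eq.trans hF (toNabla_comp_nablaMap f)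
  refine Ent.valid <| Ent.all <| Ent.imp <| Ent.ex (fun p => f (countableSupport p.2)) ?_
  have hE := (Ent.refl fun p : Unit × (nabla S).pow.carrier =>
    Set.univ ∧ʳ (chains (leRel S)).E p.2).snd
  refine (ent_tprop fun _ _ _ => rfl).and (Ent.and ?_ (ent_isSup ?_))
  · exact ent_rel_of_represents_toNabla hF hE
  · rintro ⟨_, C⟩ n hn
    exact ⟨valid_pow_of_valid_chains ⟨_, hn.2⟩, hlub _ (support_countable ⟨_, hn.2⟩)⟩

end Chains

end Eff

end EffTopos

theorem mainTheorem2 :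
    EffTopos.Eff.IsPoset EffTopos.nablaOmegaLE.{u} ∧
    EffTopos.Eff.IsChainComplete EffTopos.nablaOmegaLE.{u} ∧
    ∃ c : EffTopos.Eff.chains EffTopos.nablaOmegaLE.{u} ⟶
        EffTopos.Eff.nabla (EffTopos.Eff.CountableSubsets EffTopos.CountableOrdinal.{u}),
      c ≫ EffTopos.Eff.nablaMap EffTopos.Eff.CountableSubsets.incl =
        EffTopos.Eff.chainsIncl EffTopos.nablaOmegaLE.{u} ≫
          EffTopos.Eff.notNotClosure EffTopos.CountableOrdinal.{u} ∧
      (∀ c' : EffTopos.Eff.chains EffTopos.nablaOmegaLE.{u} ⟶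
          EffTopos.Eff.nabla (EffTopos.Eff.CountableSubsets EffTopos.CountableOrdinal.{u}),
        c' ≫ EffTopos.Eff.nablaMap EffTopos.Eff.CountableSubsets.incl =
          EffTopos.Eff.chainsIncl EffTopos.nablaOmegaLE.{u} ≫
            EffTopos.Eff.notNotClosure EffTopos.CountableOrdinal.{u} → c' = c) ∧
      EffTopos.Eff.IsChainSup EffTopos.nablaOmegaLE.{u}
        (c ≫ EffTopos.Eff.nablaMap EffTopos.CountableOrdinal.sup.{u}) := by
  have hsup := EffTopos.Eff.isChainSup_chainClosure EffTopos.CountableOrdinal.isLUB_sup.{u}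
  have hcomp := EffTopos.Eff.chainClosure_comp_incl (S := EffTopos.CountableOrdinal.{u})
  refine ⟨EffTopos.Eff.isPoset_nablaRel, hsup.isChainComplete,
    EffTopos.Eff.chainClosure EffTopos.nablaOmegaLE, hcomp, fun c' hc' => ?_, hsup⟩
  have := EffTopos.Eff.nablaMap_mono
    (f := EffTopos.Eff.CountableSubsets.incl (S := EffTopos.CountableOrdinal.{u}))
    Subtype.val_injective
  exact (cancel_mono _).1 (hc'.trans hcomp.symm)
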